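/- Let $K\ge 1$ and $F\ge 1$. Two non-colluding servers each store the same $K$ files $W_1,\dots,W_K$, each file consisting of $L$ segments $W_k[1],\dots,W_k[L]$, where all $KL$ segments are independent and uniform on $GF(2^F)$. Let $\mathcal V\subseteq GF(2)^K$ be a set of coefficient vectors. A user with $\mathbf v\in\mathcal V$ wants $\big(\sum_{k}v_kW_k[t]\big)_{t=1}^L$. The user draws a pair of queries $(Q^{(1)}_{\mathbf v},Q^{(2)}_{\mathbf v})$, independent of the files, with a joint law depending on $\mathbf v$; server $n$ replies with a binary word $A^{(n)}_{\mathbf v}$ that is a function of $Q^{(n)}_{\mathbf v}$ and the files; and the user decodes from the queries and the answers. An $(L,Q)$ scheme is such a protocol for which - (privacy) for each server $n$, the joint law of $(Q^{(n)}_{\mathbf v},A^{(n)}_{\mathbf v},W_1,\dots,W_K)$ is the same for all $\mathbf v\in\mathcal V$; - (download cost) the maximal total length of the two answers, in bits, is $QF$. Its error probability is the maximum over $\mathbf v\in\mathcal V$ of the probability that the decoded value differs from the requested combination. A rate $R$ is achievable if there is a sequence of $(L_m,Q_m)$ schemes with $L_m\to\infty$, $L_m/Q_m\to R$ and error probability tending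 to $0$; the capacity is the supremum of the achievable rates. **Theorem.** For private function retrieval with $K$ files, $N=2$ servers and binary coefficients, i.e. for $\mathcal V=GF(2)^K\setminus\{\mathbf 0\}$, the capacity is $$C=\frac12\Big(1-\frac1{2^K}\Big)^{-1}.$$ This equals the capacity of two-server private information retrieval with $K$ files, i.e. the case where $\mathcal V$ is the set of the $K$ unit vectors. Moreover, for $\mathcal V=GF(2)^K\setminus\{\mathbf 0\}$ there is an $(L,Q)$ scheme with $L=2^{K+1}$, $Q=4(2^K-1)$, hence of rate exactly $C$, and with error probability $0$. -/

import Mathlib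

open Filter Topology
open scoped ENNReal

noncomputable section

namespace PFR

/-- The stored database: `L` layers, each holding one symbol of `GF(2 ^ F)` for each of the `K`
files; `w t k` is the `t`-th segment of the `k`-th file. -/
abbrev Database (K F L : ℕ) : Type := Fin L → Fin K → GaloisField 2 F

/-- The linear combination `(v ᵀ W[t])_t` of the files with binary coefficient vector `v`. -/
def combination {K F L : ℕ} (v : Fin K → ZMod 2) (w : Database K F L) :
    Fin L → GaloisField 2 F :=
  fun t => ∑ k, v k • w t k

/-- The uniform law of the database: all segments are independent and uniform on `GF(2 ^ F)`. -/
def databaseLaw (K F L : ℕ) : PMF (Database K F L) :=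
  letI : Fintype (Database K F L) := Fintype.ofFinite _
  PMF.uniformOfFintype (Database K F L)

/-- The data of a retrieval protocol with `N` servers, all storing the same database, for a user
whose coefficient vector ranges over `𝒱`.  The user draws the `N` queries from a joint law that
depends on the vector only, every server answers with a word over `GF(2)` that is a function of its
query and of the database, and the user decodes from the queries and the answers. -/
structure Protocol {K : ℕ} (𝒱 : Set (Fin K → ZMod 2)) (N F L : ℕ) where
  /-- The query alphabet of each server. -/
  Query : Fin N → Type
  /-- The joint law of the `N` queries for a given coefficient vector. -/
  queryLaw : 𝒱 → PMF ((n : Fin N) → Query n)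
  /-- The answering function of each server. -/
  answer : (n : Fin N) → Query n → Database K F L → List (ZMod 2)
  /-- The decoding functions. -/
  decode : 𝒱 → ((n : Fin N) → Query n) → (Fin N → List (ZMod 2)) → (Fin L → GaloisField 2 F)

namespace Protocol

variable {K : ℕ} {𝒱 : Set (Fin K → ZMod 2)} {N F L : ℕ}

/-- The joint law of the queries and the database: the queries are independent of the database,
which is uniform. -/
def jointLaw (P : Protocol 𝒱 N F L) (v : 𝒱) :
    PMF (((n : Fin N) → P.Query n) × Database K F L) :=
  (P.queryLaw v).bind fun q => (databaseLaw K F L).map fun w => (q, w)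

/-- The joint law of the query to server `n`, its answer, and the database. -/
def serverLaw (P : Protocol 𝒱 N F L) (n : Fin N) (v : 𝒱) :
    PMF (P.Query n × List (ZMod 2) × Database K F L) :=
  (P.jointLaw v).map fun x => (x.1 n, P.answer n (x.1 n) x.2, x.2)

/-- No single server learns anything about the coefficient vector: what it sees has the same law
for every choice of the vector. -/
def IsPrivate (P : Protocol 𝒱 N F L) : Prop :=
  ∀ (n : Fin N) (v v' : 𝒱), P.serverLaw n v = P.serverLaw n v'

/-- The maximal total number of downloaded bits (over the coefficient vectors, the queries of
positive probability, and the databases) equals `d`. -/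
def HasDownloadCost (P : Protocol 𝒱 N F L) (d : ℕ) : Prop :=
  IsGreatest
    {b : ℕ | ∃ (v : 𝒱) (q : (n : Fin N) → P.Query n) (w : Database K F L),
      q ∈ (P.queryLaw v).support ∧ b = ∑ n, (P.answer n (q n) w).length} d

/-- The probability that the decoded word differs from the requested combination, maximized over
the coefficient vectors. -/
def errorProb (P : Protocol 𝒱 N F L) : ℝ≥0∞ :=
  ⨆ v : 𝒱, (P.jointLaw v).toOuterMeasure
    {x | P.decode v x.1 (fun n => P.answer n (x.1 n) x.2) ≠ combination (v : Fin K → ZMod 2) x.2}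

end Protocol

/-- An `(L, Q)` scheme: a private protocol for `L` layers whose download cost is `Q * F` bits, that
is, the size of `Q` symbols of `GF(2 ^ F)`. -/
structure Scheme {K : ℕ} (𝒱 : Set (Fin K → ZMod 2)) (N F L Q : ℕ) extends
    Protocol 𝒱 N F L where
  isPrivate : toProtocol.IsPrivate
  hasDownloadCost : toProtocol.HasDownloadCost (Q * F)

/-- `R` is achievable if it is the limit of the rates `L / Q` of a sequence of `(L, Q)` schemes with
`L → ∞` whose error probabilities tend to zero. -/
def IsAchievable {K : ℕ} (𝒱 : Set (Fin K → ZMod 2)) (N F : ℕ) (R : ℝ) : Prop :=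
  ∃ (L Q : ℕ → ℕ) (S : (m : ℕ) → Scheme 𝒱 N F (L m) (Q m)),
    Tendsto L atTop atTop ∧
    Tendsto (fun m => (L m : ℝ) / (Q m : ℝ)) atTop (𝓝 R) ∧
    Tendsto (fun m => (S m).errorProb) atTop (𝓝 0)

/-- The capacity is the supremum of the achievable rates. -/
def IsCapacity {K : ℕ} (𝒱 : Set (Fin K → ZMod 2)) (N F : ℕ) (C : ℝ) : Prop :=
  IsLUB {R : ℝ | IsAchievable 𝒱 N F R} C

/-- Private function retrieval with binary coefficients: all nonzero vectors may be requested. -/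
def functionVectors (K : ℕ) : Set (Fin K → ZMod 2) := {v | v ≠ 0}

/-- Private information retrieval: one of the `K` files itself is requested. -/
def fileVectors (K : ℕ) : Set (Fin K → ZMod 2) := Set.range fun k => Pi.single k 1

end PFR

end

/-! Scheme: index layers by copies of `GF(2)^K`, draw `c` uniformly, and query the servers with `c`
and `c + v`. In layer `(i, t)` they return the combinations with coefficients `t + c` and `t + c +
v`, whose sum is the requested one. Each query alone is uniform, hence private. The layers whose
coefficient vector vanishes are not sent, so each server sends `2^K - 1` symbols per `2^K` layers.
This serves any nonempty family of vectors.

Converse, needing only the unit vectors: let `H j v` be the entropy of both answers given the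
queries and the first `j` files. Decoding file `j` (numbered from 0) gives `H j e_j ≥ a + H (j+1)
e_j`, with `a` the entropy of a file less Fano's correction (`log_add_answerEntropy_le`). By privacy
and subadditivity, `H j v' ≤ 2 * H j v` (`answerEntropy_le_two_mul`). Downward recursion from `H K ≥
0` yields `H 0 e_0 ≥ 2a(1 - 2^{-K})`, while `H 0` is at most the download cost plus a logarithmic
term. Dividing by the cost and passing to the limit bounds the rate.

Since the database is uniform and finite, entropies are obtained by counting fibers. -/

noncomputable section

namespace PFR

/-! ### Entropy by counting fibers -/

section Fibers

variable {Ω α β γ : Type*} [Fintype Ω]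

open Classical in
/-- The number of points at which `f` takes the same value as at `x`. -/
def fiberCard (f : Ω → α) (x : Ω) : ℕ := (Finset.univ.filter fun y => f y = f x).card

theorem fiberCard_eq_card_filter [DecidableEq α] (f : Ω → α) (x : Ω) :
    fiberCard f x = (Finset.univ.filter fun y => f y = f x).card := by
  unfold fiberCard
  congr!

theorem fiberCard_pos (f : Ω → α) (x : Ω) : 0 < fiberCard f x :=
  Finset.card_pos.2 ⟨x, by simp⟩

theorem fiberCard_le_of_factors {f : Ω → α} {g : Ω → β} (h : ∀ x y, f x = f y → g x = g y)
    (x : Ω) : fiberCard f x ≤ fiberCard g x :=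
  Finset.card_le_card fun y => by simpa using h y x

/-- The sum over all points of the logarithm of the size of the fiber.  For a uniform point, the
conditional entropy of `f` given `g` is `(fiberLog g - fiberLog (f, g)) / |Ω|`. -/
def fiberLog (f : Ω → α) : ℝ := ∑ x, Real.log (fiberCard f x)

theorem fiberLog_le_of_factors {f : Ω → α} {g : Ω → β} (h : ∀ x y, f x = f y → g x = g y) :
    fiberLog f ≤ fiberLog g :=
  Finset.sum_le_sum fun _ _ => Real.log_le_log (by exact_mod_cast fiberCard_pos f _)
    (by exact_mod_cast fiberCard_le_of_factors h _)

theorem fiberLog_congr {f : Ω → α} {g : Ω → β} (h : ∀ x y, f x = f y ↔ g x = g y) :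
    fiberLog f = fiberLog g :=
  le_antisymm (fiberLog_le_of_factors fun x y => (h x y).1)
    (fiberLog_le_of_factors fun x y => (h x y).2)

theorem fiberLog_nonneg (f : Ω → α) : 0 ≤ fiberLog f :=
  Finset.sum_nonneg fun _ _ => Real.log_natCast_nonneg _

theorem fiberLog_const (a : α) :
    fiberLog (fun _ : Ω => a) = Fintype.card Ω * Real.log (Fintype.card Ω) := by
  simp [fiberLog, fiberCard]

/-- Weighting every point by the inverse size of its fiber is summation over the values. -/
theorem sum_div_fiberCard (f : Ω → α) (g : α → ℝ) [DecidableEq α] :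
    ∑ x, g (f x) / fiberCard f x = ∑ a ∈ Finset.univ.image f, g a := by
  classical
  rw [← Finset.sum_fiberwise_of_maps_to (g := f) (t := Finset.univ.image f) (by simp)]
  refine Finset.sum_congr rfl fun a ha => ?_
  obtain ⟨x, -, rfl⟩ := Finset.mem_image.1 ha
  have h : ∀ y ∈ Finset.univ.filter (fun y => f y = f x),
      g (f y) / fiberCard f y = g (f x) / fiberCard f x := by
    intro y hy
    have hy : f y = f x := by simpa using hy
    simp only [fiberCard_eq_card_filter, hy]
  rw [Finset.sum_congr rfl h, Finset.sum_const, nsmul_eq_mul]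
  have h0 : (fiberCard f x : ℝ) ≠ 0 := by exact_mod_cast (fiberCard_pos f x).ne'
  rw [← fiberCard_eq_card_filter]
  field_simp

/-- Gibbs' inequality. -/
theorem sum_log_le_fiberLog (f : Ω → α) (g : α → ℝ) (hg : ∀ x, 0 < g (f x))
    (h : ∑ x, g (f x) / fiberCard f x ≤ Fintype.card Ω) :
    ∑ x, Real.log (g (f x)) ≤ fiberLog f := by
  -- This is `log t ≤ t - 1`; by `h` the corrections sum to at most zero.
  have key : ∀ x, Real.log (g (f x)) ≤
      Real.log (fiberCard f x) + (g (f x) / fiberCard f x - 1) := by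
    intro x
    have h0 : (0 : ℝ) < fiberCard f x := by exact_mod_cast fiberCard_pos f x
    have := Real.log_le_sub_one_of_pos (div_pos (hg x) h0)
    rw [Real.log_div (hg x).ne' h0.ne'] at this
    linarith
  calc ∑ x, Real.log (g (f x))
      ≤ ∑ x, (Real.log (fiberCard f x) + (g (f x) / fiberCard f x - 1)) :=
        Finset.sum_le_sum fun x _ => key x
    _ = fiberLog f + (∑ x, g (f x) / fiberCard f x - Fintype.card Ω) := by
        rw [Finset.sum_add_distrib, Finset.sum_sub_distrib]
        simp [fiberLog]
    _ ≤ fiberLog f := by linarith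

/-- The sum over the values of `f` of the fiber sizes is the number of points. -/
theorem sum_image_card (f : Ω → α) [DecidableEq α] :
    ∑ a ∈ Finset.univ.image f, ((Finset.univ.filter fun x => f x = a).card : ℝ) =
      Fintype.card Ω := by
  rw [← Finset.card_univ, Finset.card_eq_sum_card_image f Finset.univ]
  push_cast
  rfl

/-- A map with at most `n` values has entropy at most `log n`. -/
theorem card_mul_log_card_sub_fiberLog_le (f : Ω → α) [DecidableEq α] {n : ℕ} [Nonempty Ω]
    (h : (Finset.univ.image f).card ≤ n) :
    Fintype.card Ω * Real.log (Fintype.card Ω) - fiberLog f ≤ Fintype.card Ω * Real.log n := by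
  have hn : 0 < n := lt_of_lt_of_le (Finset.card_pos.2 (Finset.univ_nonempty.image f)) h
  have hn' : (0 : ℝ) < n := by exact_mod_cast hn
  have hΩ : (0 : ℝ) < Fintype.card Ω := by exact_mod_cast Fintype.card_pos
  have := sum_log_le_fiberLog f (fun _ => (Fintype.card Ω : ℝ) / n) (fun _ => by positivity) (by
    rw [sum_div_fiberCard f (fun _ => (Fintype.card Ω : ℝ) / n), Finset.sum_const, nsmul_eq_mul,
      mul_div_assoc', div_le_iff₀ hn', mul_comm]
    gcongr)
  simp only [Finset.sum_const, Finset.card_univ, nsmul_eq_mul,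
    Real.log_div hΩ.ne' hn'.ne'] at this
  linarith

/-- Subadditivity of the conditional entropy given `s`. -/
theorem fiberLog_add_fiberLog_le (f : Ω → α) (g : Ω → β) (s : Ω → γ) :
    fiberLog (fun x => (f x, s x)) + fiberLog (fun x => (g x, s x)) ≤
      fiberLog (fun x => ((f x, g x), s x)) + fiberLog s := by
  classical
  let cf : α × γ → ℝ := fun a => (Finset.univ.filter fun x => (f x, s x) = a).card
  let cg : β × γ → ℝ := fun a => (Finset.univ.filter fun x => (g x, s x) = a).card
  let cs : γ → ℝ := fun a => (Finset.univ.filter fun x => s x = a).card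
  have hcf : ∀ x, cf (f x, s x) = fiberCard (fun x => (f x, s x)) x := fun x => by
    simp [cf, fiberCard]
  have hcg : ∀ x, cg (g x, s x) = fiberCard (fun x => (g x, s x)) x := fun x => by
    simp [cg, fiberCard]
  have hcs : ∀ x, cs (s x) = fiberCard s x := fun x => by
    simp [cs, fiberCard]
  have pf : ∀ x, 0 < cf (f x, s x) := fun x => by
    rw [hcf]; exact_mod_cast fiberCard_pos _ x
  have pg : ∀ x, 0 < cg (g x, s x) := fun x => by
    rw [hcg]; exact_mod_cast fiberCard_pos _ x
  have ps : ∀ x, 0 < cs (s x) := fun x => by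
    rw [hcs]; exact_mod_cast fiberCard_pos _ x
  -- The weight making `f` and `g` conditionally independent given `s`; over the product of the
  -- ranges it sums to `|Ω|`, as Gibbs' inequality requires.
  let h : (α × β) × γ → ℝ := fun a => cf (a.1.1, a.2) * cg (a.1.2, a.2) / cs a.2
  have hsumf : ∀ c, ∑ a ∈ Finset.univ.image f, cf (a, c) = cs c := fun c => by
    simp only [cf, cs]
    rw [Finset.card_eq_sum_card_fiberwise (f := f) (t := Finset.univ.image f)
      (s := Finset.univ.filter fun x => s x = c) (by intro x; simp)]
    push_cast
    refine Finset.sum_congr rfl fun a _ => ?_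
    congr 2
    ext x; simp [and_comm]
  have hsumg : ∀ c, ∑ a ∈ Finset.univ.image g, cg (a, c) = cs c := fun c => by
    simp only [cg, cs]
    rw [Finset.card_eq_sum_card_fiberwise (f := g) (t := Finset.univ.image g)
      (s := Finset.univ.filter fun x => s x = c) (by intro x; simp)]
    push_cast
    refine Finset.sum_congr rfl fun a _ => ?_
    congr 2
    ext x; simp [and_comm]
  have hnn : ∀ a, 0 ≤ h a := fun a => by positivity
  have main := sum_log_le_fiberLog (fun x => ((f x, g x), s x)) h
    (fun x => div_pos (mul_pos (pf x) (pg x)) (ps x)) (by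
      rw [sum_div_fiberCard (fun x => ((f x, g x), s x)) h]
      calc ∑ a ∈ Finset.univ.image (fun x => ((f x, g x), s x)), h a
          ≤ ∑ a ∈ (Finset.univ.image f ×ˢ Finset.univ.image g) ×ˢ Finset.univ.image s, h a := by
            refine Finset.sum_le_sum_of_subset_of_nonneg ?_ fun a _ _ => hnn a
            intro a ha
            obtain ⟨x, -, rfl⟩ := Finset.mem_image.1 ha
            simp
        _ = ∑ c ∈ Finset.univ.image s, cs c := by
            rw [Finset.sum_product_right]
            refine Finset.sum_congr rfl fun c hc => ?_
            obtain ⟨x, -, rfl⟩ := Finset.mem_image.1 hc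
            simp only [h]
            rw [← Finset.sum_div, Finset.sum_product]
            simp only
            rw [← Finset.sum_mul_sum, hsumf, hsumg, mul_div_assoc, div_self (ps x).ne', mul_one]
        _ = Fintype.card Ω := sum_image_card s)
  have e : ∀ x, Real.log (h ((f x, g x), s x)) =
      Real.log (fiberCard (fun x => (f x, s x)) x) + Real.log (fiberCard (fun x => (g x, s x)) x)
        - Real.log (fiberCard s x) := fun x => by
    simp only [h]
    rw [Real.log_div (mul_pos (pf x) (pg x)).ne' (ps x).ne',
      Real.log_mul (pf x).ne' (pg x).ne', hcf, hcg, hcs]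
  simp only [e, Finset.sum_sub_distrib, Finset.sum_add_distrib] at main
  simp only [fiberLog] at main ⊢
  linarith

open Classical in
/-- Fano's inequality: if `d ∘ f` guesses `g`, which has at most `M` values, then the entropy of `g`
given `f` is bounded in terms of the number of wrong guesses. -/
theorem fiberLog_sub_fiberLog_le_of_guess (f : Ω → α) (g : Ω → β) [Fintype β] (d : α → β) :
    fiberLog f - fiberLog (fun x => (f x, g x)) ≤
      Fintype.card Ω * Real.log 2 +
        (Finset.univ.filter fun x => d (f x) ≠ g x).card * Real.log (Fintype.card β) := by
  rcases isEmpty_or_nonempty Ω with hΩ | ⟨⟨x₀⟩⟩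
  · simp [fiberLog]
  have hM : (0 : ℝ) < Fintype.card β := by
    exact_mod_cast Fintype.card_pos_iff.2 ⟨g x₀⟩
  let cf : α → ℝ := fun a => (Finset.univ.filter fun x => f x = a).card
  have hcf : ∀ x, cf (f x) = fiberCard f x := fun x => by simp [cf, fiberCard]
  have pf : ∀ x, 0 < cf (f x) := fun x => by
    rw [hcf]; exact_mod_cast fiberCard_pos _ x
  -- Half of the mass goes to the guess, half is spread over `β`: a correct guess costs `log 2`, a
  -- wrong one `log 2 + log |β|`.
  let r : α × β → ℝ := fun a => if d a.1 = a.2 then 1 / 2 else 1 / (2 * Fintype.card β)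
  have pr : ∀ a, 0 < r a := fun a => by
    simp only [r]; split_ifs <;> positivity
  have hr : ∀ a, ∑ b, r (a, b) ≤ 1 := fun a => by
    calc ∑ b, r (a, b)
        ≤ ∑ b, ((if d a = b then 1 / 2 else 0) + 1 / (2 * (Fintype.card β : ℝ))) := by
          refine Finset.sum_le_sum fun b _ => ?_
          simp only [r]
          have : (0 : ℝ) ≤ 1 / (2 * (Fintype.card β : ℝ)) := by positivity
          split_ifs <;> linarith
      _ = 1 := by
          rw [Finset.sum_add_distrib]
          simp only [Finset.sum_ite_eq, Finset.mem_univ, if_true, Finset.sum_const,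
            Finset.card_univ, nsmul_eq_mul]
          field_simp
          norm_num
  have main := sum_log_le_fiberLog (fun x => (f x, g x)) (fun a => cf a.1 * r a)
    (fun x => mul_pos (pf x) (pr _)) (by
      rw [sum_div_fiberCard (fun x => (f x, g x)) (fun a => cf a.1 * r a)]
      calc ∑ a ∈ Finset.univ.image (fun x => (f x, g x)), cf a.1 * r a
          ≤ ∑ a ∈ Finset.univ.image f ×ˢ (Finset.univ : Finset β), cf a.1 * r a := by
            refine Finset.sum_le_sum_of_subset_of_nonneg ?_
              fun a _ _ => mul_nonneg (by positivity) (pr a).le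
            intro a ha
            obtain ⟨x, -, rfl⟩ := Finset.mem_image.1 ha
            simp
        _ ≤ ∑ a ∈ Finset.univ.image f, cf a := by
            rw [Finset.sum_product]
            refine Finset.sum_le_sum fun a _ => ?_
            simp only
            rw [← Finset.mul_sum]
            exact mul_le_of_le_one_right (by positivity) (hr a)
        _ = Fintype.card Ω := sum_image_card f)
  have e : ∀ x, Real.log (cf (f x) * r (f x, g x)) = Real.log (fiberCard f x) -
      (Real.log 2 + if d (f x) ≠ g x then Real.log (Fintype.card β) else 0) := fun x => by
    rw [Real.log_mul (pf x).ne' (pr _).ne', hcf]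
    simp only [r]
    split_ifs with h1 h2
    · exact absurd h1 h2
    · rw [one_div, Real.log_inv]; ring
    · rw [one_div, Real.log_inv, Real.log_mul two_ne_zero hM.ne']; ring
  simp only [e, Finset.sum_sub_distrib, Finset.sum_add_distrib, ← Finset.sum_filter,
    Finset.sum_const, nsmul_eq_mul, Finset.card_univ] at main
  simp only [fiberLog] at main ⊢
  linarith

end Fibers

/-! ### Privacy and query marginals -/

instance (K F L : ℕ) : Fintype (Database K F L) := Fintype.ofFinite _

theorem card_galoisField {F : ℕ} (hF : 1 ≤ F) : Nat.card (GaloisField 2 F) = 2 ^ F :=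
  GaloisField.card 2 F (by omega)

namespace Protocol

variable {K : ℕ} {𝒱 : Set (Fin K → ZMod 2)} {N F L : ℕ}

/-- An answer depends only on the server's own query and the database, so privacy amounts to
equality of the marginal query laws. -/
theorem serverLaw_eq_bind (P : Protocol 𝒱 N F L) (n : Fin N) (v : 𝒱) :
    P.serverLaw n v = ((P.queryLaw v).map fun q => q n).bind fun c =>
      (databaseLaw K F L).map fun w => (c, P.answer n c w, w) := by
  simp only [serverLaw, jointLaw, PMF.map_bind, PMF.map_comp, PMF.bind_map]
  rfl

/-- In a private protocol the law of the query to each server does not depend on the vector. -/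
theorem IsPrivate.map_queryLaw_eq {P : Protocol 𝒱 N F L} (hP : P.IsPrivate) (n : Fin N)
    (v v' : 𝒱) : ((P.queryLaw v).map fun q => q n) = (P.queryLaw v').map fun q => q n := by
  have key : ∀ u, (P.serverLaw n u).map Prod.fst = (P.queryLaw u).map fun q => q n := fun u => by
    rw [serverLaw_eq_bind, PMF.map_bind]
    simp only [PMF.map_comp]
    have : ∀ c, (databaseLaw K F L).map (Prod.fst ∘ fun w => (c, P.answer n c w, w)) =
        PMF.pure c := fun c => PMF.map_const _ _
    simp only [this, PMF.bind_pure]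
  rw [← key, ← key, hP n v v']

end Protocol

/-! ### The scheme attaining capacity -/

/-- Elements of a type with `2 ^ n` elements can be written as binary words of length `n`. -/
theorem exists_word_encoding {α : Type*} [Finite α] [Nonempty α] {n : ℕ}
    (h : Nat.card α = 2 ^ n) :
    ∃ (enc : α → List (ZMod 2)) (dec : List (ZMod 2) → α),
      (∀ a, (enc a).length = n) ∧ ∀ a, dec (enc a) = a := by
  obtain ⟨e⟩ : Nonempty (α ≃ (Fin n → ZMod 2)) :=
    Finite.card_eq.1 (by simp [h])
  have hinj : Function.Injective fun a => List.ofFn (e a) :=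
    List.ofFn_injective.comp e.injective
  exact ⟨fun a => List.ofFn (e a), Function.invFun fun a => List.ofFn (e a), by simp,
    Function.leftInverse_invFun hinj⟩

/-- The answers of the translation scheme: with layers indexed by `ι × GF(2)^K`, the query `c` asks
in layer `(i, t)` for the combination with coefficient vector `t + c`, and the layers with
`t + c = 0` need not be transmitted. -/
theorem exists_translation_answer {K F L : ℕ} (hF : 1 ≤ F) {ι : Type*} [Fintype ι]
    (e : ι × (Fin K → ZMod 2) ≃ Fin L) :
    ∃ (ans : (Fin K → ZMod 2) → Database K F L → List (ZMod 2))
      (rec : (Fin K → ZMod 2) → List (ZMod 2) → Fin L → GaloisField 2 F),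
      (∀ c w, (ans c w).length = Fintype.card ι * (2 ^ K - 1) * F) ∧
      ∀ c w l, rec c (ans c w) l = ∑ k, ((e.symm l).2 + c) k • w l k := by
  have hcard : ∀ c : Fin K → ZMod 2,
      Nat.card (ι × {t : Fin K → ZMod 2 // t ≠ c} → GaloisField 2 F) =
        2 ^ (Fintype.card ι * (2 ^ K - 1) * F) := fun c => by
    rw [Nat.card_fun, card_galoisField hF, ← pow_mul]
    simp [Fintype.card_subtype_compl, mul_comm]
  choose enc dec hlen hdec using fun c => exists_word_encoding (hcard c)
  refine ⟨fun c w => enc c fun p => ∑ k, (p.2.1 + c) k • w (e (p.1, p.2.1)) k,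
    -- The default 0 is the true value of the omitted layer: for `t = c` the coefficient vector is
    -- `c + c = 0`.
    fun c a l => if h : (e.symm l).2 ≠ c then dec c a ((e.symm l).1, ⟨(e.symm l).2, h⟩) else 0,
    fun c w => hlen c _, fun c w l => ?_⟩
  dsimp only
  split_ifs with h
  · simp [hdec]
  · rw [not_not] at h
    simp [h, CharTwo.add_self_eq_zero]

theorem exists_scheme_errorProb_eq_zero {K F L Q m : ℕ} {𝒱 : Set (Fin K → ZMod 2)}
    (h𝒱 : 𝒱.Nonempty) (hF : 1 ≤ F) (hL : L = m * 2 ^ K) (hQ : Q = 2 * (m * (2 ^ K - 1))) :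
    ∃ S : Scheme 𝒱 2 F L Q, S.errorProb = 0 := by
  have e : Fin m × (Fin K → ZMod 2) ≃ Fin L := Fintype.equivOfCardEq (by simp [hL])
  obtain ⟨ans, rec, hlen, hrec⟩ := exists_translation_answer (F := F) hF e
  let P : Protocol 𝒱 2 F L :=
    { Query := fun _ => Fin K → ZMod 2
      queryLaw := fun v => (PMF.uniformOfFintype (Fin K → ZMod 2)).map fun c n =>
        if n = 0 then c else c + v
      answer := fun _ => ans
      decode := fun _ q a l => rec (q 0) (a 0) l + rec (q 1) (a 1) l }
  have hmarg : ∀ n v, ((P.queryLaw v).map fun q => q n) =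
      PMF.uniformOfFintype (Fin K → ZMod 2) := by
    intro n v
    have hmap : ∀ σ : Equiv.Perm (Fin K → ZMod 2),
        (PMF.uniformOfFintype (Fin K → ZMod 2)).map σ = PMF.uniformOfFintype _ := fun σ => by
      ext b
      rw [PMF.map_apply, tsum_eq_single (σ.symm b)]
      · simp
      · intro a ha
        rw [if_neg]
        rintro rfl
        simp at ha
    simp only [P, PMF.map_comp]
    fin_cases n
    · exact hmap (Equiv.refl _)
    · exact hmap (Equiv.addRight (v : Fin K → ZMod 2))
  have hpriv : P.IsPrivate := fun n v v' => by
    rw [P.serverLaw_eq_bind, P.serverLaw_eq_bind, hmarg, hmarg]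
  have hcost : ∀ (q : (n : Fin 2) → P.Query n) w,
      ∑ n, (P.answer n (q n) w).length = Q * F := fun q w => by
    rw [Fin.sum_univ_two]
    change (ans (q 0) w).length + (ans (q 1) w).length = _
    rw [hlen, hlen, hQ, Fintype.card_fin]
    ring
  refine ⟨⟨P, hpriv, ⟨?_, ?_⟩⟩, ?_⟩
  -- The maximal cost must be attained, so some vector is needed.
  · obtain ⟨v, hv⟩ := h𝒱
    obtain ⟨q, hq⟩ := (P.queryLaw ⟨v, hv⟩).support_nonempty
    exact ⟨⟨v, hv⟩, q, 0, hq, (hcost q 0).symm⟩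
  · rintro b ⟨v, q, w, -, rfl⟩
    exact (hcost q w).le
  · simp only [Protocol.errorProb, ENNReal.iSup_eq_zero]
    intro v
    rw [PMF.toOuterMeasure_apply_eq_zero_iff, Set.disjoint_left]
    intro x hx
    simp only [Protocol.jointLaw, PMF.mem_support_bind_iff, PMF.support_map] at hx
    obtain ⟨q, hq, w, -, rfl⟩ := hx
    simp only [P, PMF.support_map] at hq
    obtain ⟨c, -, rfl⟩ := hq
    refine not_not.2 ?_
    simp only [P]
    funext l
    rw [hrec, hrec, combination, ← Finset.sum_add_distrib]
    refine Finset.sum_congr rfl fun k _ => ?_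
    rw [← add_smul]
    congr 1
    simp only [if_true, Fin.one_eq_zero_iff, Pi.add_apply]
    simp
    linear_combination CharTwo.add_self_eq_zero ((e.symm l).2 k + c k)

/-! ### Conditional entropy -/

section CondEntropy

variable {Ω α β γ : Type*} [Fintype Ω]

/-- The conditional entropy, in nats, of `f` given `s` for a uniformly distributed point. -/
def condEntropy (f : Ω → α) (s : Ω → γ) : ℝ :=
  (fiberLog s - fiberLog fun x => (f x, s x)) / Fintype.card Ω

theorem condEntropy_nonneg (f : Ω → α) (s : Ω → γ) : 0 ≤ condEntropy f s :=
  div_nonneg (sub_nonneg.2 (fiberLog_le_of_factors fun _ _ h => (Prod.ext_iff.1 h).2))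
    (Nat.cast_nonneg _)

theorem condEntropy_le_of_factors {f : Ω → α} {g : Ω → β} (s : Ω → γ)
    (h : ∀ x y, f x = f y → g x = g y) : condEntropy g s ≤ condEntropy f s := by
  refine div_le_div_of_nonneg_right (sub_le_sub_left (fiberLog_le_of_factors fun x y e => ?_) _)
    (Nat.cast_nonneg _)
  rw [Prod.ext_iff] at e ⊢
  exact ⟨h x y e.1, e.2⟩

theorem condEntropy_prod_le (f : Ω → α) (g : Ω → β) (s : Ω → γ) :
    condEntropy (fun x => (f x, g x)) s ≤ condEntropy f s + condEntropy g s := by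
  rw [condEntropy, condEntropy, condEntropy, ← add_div]
  refine div_le_div_of_nonneg_right ?_ (Nat.cast_nonneg _)
  linarith [fiberLog_add_fiberLog_le f g s]

theorem condEntropy_le_log_card [Nonempty Ω] (f : Ω → α) (s : Ω → γ) :
    condEntropy f s ≤ Real.log (Fintype.card Ω) := by
  have hΩ : (0 : ℝ) < Fintype.card Ω := by exact_mod_cast Fintype.card_pos
  rw [condEntropy, div_le_iff₀ hΩ]
  have h1 := fiberLog_le_of_factors (f := s) (g := fun _ : Ω => ()) fun _ _ _ => rfl
  rw [fiberLog_const] at h1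
  linarith [fiberLog_nonneg fun x => (f x, s x)]

theorem condEntropy_const_le [Nonempty Ω] [DecidableEq α] (f : Ω → α) (a : γ) {n : ℕ}
    (h : (Finset.univ.image f).card ≤ n) :
    condEntropy f (fun _ => a) ≤ Real.log n := by
  have hΩ : (0 : ℝ) < Fintype.card Ω := by exact_mod_cast Fintype.card_pos
  rw [condEntropy, div_le_iff₀ hΩ, fiberLog_const,
    fiberLog_congr (f := fun x => (f x, a)) (g := f) (by simp)]
  linarith [card_mul_log_card_sub_fiberLog_le f h]

end CondEntropy

/-! ### Averaging over queries -/

section Average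

variable {α β : Type*}

/-- The mean of a nonnegative function under a probability mass function. -/
def mean (p : PMF α) (g : α → ℝ≥0∞) : ℝ≥0∞ := ∑' a, p a * g a

/-- Values in `ℝ≥0∞` let sums be exchanged without summability conditions; query alphabets may be
infinite. -/
theorem mean_map (p : PMF α) (f : α → β) (g : β → ℝ≥0∞) :
    mean (p.map f) g = mean p fun a => g (f a) := by
  classical
  simp only [mean, PMF.map_apply]
  simp_rw [← ENNReal.tsum_mul_right]
  rw [ENNReal.tsum_comm]
  refine tsum_congr fun a => ?_
  rw [tsum_eq_single (f a)]
  · simp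
  · intro b hb
    simp [hb]

theorem mean_mono {p : PMF α} {g h : α → ℝ≥0∞} (H : ∀ a ∈ p.support, g a ≤ h a) :
    mean p g ≤ mean p h := by
  refine ENNReal.tsum_le_tsum fun a => ?_
  by_cases ha : p a = 0
  · simp [ha]
  · gcongr
    exact H a ((p.mem_support_iff a).2 ha)

theorem mean_add (p : PMF α) (g h : α → ℝ≥0∞) :
    (mean p fun a => g a + h a) = mean p g + mean p h := by
  simp only [mean, mul_add, ENNReal.tsum_add]

theorem mean_const (p : PMF α) (c : ℝ≥0∞) : (mean p fun _ => c) = c := by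
  simp [mean, ENNReal.tsum_mul_right, p.tsum_coe]

theorem mean_mul_const (p : PMF α) (g : α → ℝ≥0∞) (c : ℝ≥0∞) :
    (mean p fun a => g a * c) = mean p g * c := by
  simp only [mean, ← mul_assoc, ENNReal.tsum_mul_right]

end Average

/-! ### Entropy of successive files -/

section FilesBelow

variable {K F L : ℕ}

instance : Fintype (Fin L → GaloisField 2 F) := Fintype.ofFinite _

/-- The first `j` files of the database; the other ones are replaced by zero. -/
def filesBelow (j : ℕ) (w : Database K F L) : Database K F L :=
  fun t k => if (k : ℕ) < j then w t k else 0

theorem filesBelow_eq_iff {j : ℕ} {w w' : Database K F L} :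
    filesBelow j w = filesBelow j w' ↔ ∀ t (k : Fin K), (k : ℕ) < j → w t k = w' t k := by
  simp only [funext_iff, filesBelow]
  refine forall_congr' fun t => forall_congr' fun k => ?_
  split_ifs with h <;> simp [h]

theorem filesBelow_succ_eq_iff (j : Fin K) {w w' : Database K F L} :
    filesBelow (j + 1) w = filesBelow (j + 1) w' ↔
      filesBelow j w = filesBelow j w' ∧ ∀ t, w t j = w' t j := by
  simp only [filesBelow_eq_iff]
  constructor
  · exact fun h => ⟨fun t k hk => h t k (by omega), fun t => h t j (by omega)⟩
  · rintro ⟨h1, h2⟩ t k hk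
    rcases Nat.lt_succ_iff_lt_or_eq.1 hk with h | h
    · exact h1 t k h
    · rw [Fin.ext h]
      exact h2 t

theorem card_layers (hF : 1 ≤ F) : Fintype.card (Fin L → GaloisField 2 F) = 2 ^ (L * F) := by
  rw [← Nat.card_eq_fintype_card, Nat.card_fun, card_galoisField hF, ← pow_mul]
  simp [mul_comm]

/-- Overwriting file `j` arbitrarily keeps the first `j` files. The map is injective because file
`j` was constant on the smaller fiber. -/
theorem mul_fiberCard_filesBelow_succ_le (j : Fin K) (w : Database K F L) :
    Fintype.card (Fin L → GaloisField 2 F) * fiberCard (filesBelow (j + 1)) w ≤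
      fiberCard (filesBelow (j : ℕ)) w := by
  classical
  rw [fiberCard_eq_card_filter, fiberCard_eq_card_filter, ← Finset.card_univ,
    ← Finset.card_product]
  refine Finset.card_le_card_of_injOn
    (fun p => fun t => Function.update (p.2 t) j (p.1 t)) ?_ ?_
  · rintro ⟨x, w'⟩ h
    have h : filesBelow (j + 1) w' = filesBelow (j + 1) w := by simpa using h
    have h' := filesBelow_eq_iff.1 ((filesBelow_succ_eq_iff j).1 h).1
    simp only [Finset.coe_filter, Finset.mem_univ, true_and]
    refine filesBelow_eq_iff.2 fun t k hk => ?_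
    rw [Function.update_of_ne (by rintro rfl; exact lt_irrefl _ hk)]
    exact h' t k hk
  · rintro ⟨x, u⟩ hu ⟨y, u'⟩ hu' h
    have hu : filesBelow (j + 1) u = filesBelow (j + 1) w := by simpa using hu
    have hu' : filesBelow (j + 1) u' = filesBelow (j + 1) w := by simpa using hu'
    have huu := ((filesBelow_succ_eq_iff j).1 (hu.trans hu'.symm)).2
    have h (t k) := congrFun (congrFun h t) k
    dsimp only at h
    refine Prod.ext (funext fun t => by simpa using h t j) (funext fun t => funext fun k => ?_)
    by_cases hk : k = j
    · subst hk
      exact huu t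
    · simpa [hk] using h t k

theorem fiberLog_filesBelow_succ_le (hF : 1 ≤ F) (j : Fin K) :
    Fintype.card (Database K F L) * (L * F * Real.log 2) +
        fiberLog (filesBelow (j + 1) : Database K F L → _) ≤
      fiberLog (filesBelow j : Database K F L → _) := by
  simp only [fiberLog]
  rw [← Finset.card_univ, ← nsmul_eq_mul, ← Finset.sum_const, ← Finset.sum_add_distrib]
  refine Finset.sum_le_sum fun w _ => ?_
  have h0 : (0 : ℝ) < fiberCard (filesBelow (j + 1)) w := by exact_mod_cast fiberCard_pos _ w
  have h := mul_fiberCard_filesBelow_succ_le j w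
  rw [card_layers hF] at h
  have h' : ((2 : ℝ) ^ (L * F) * fiberCard (filesBelow (j + 1)) w) ≤
      fiberCard (filesBelow (j : ℕ)) w := by exact_mod_cast h
  have := Real.log_le_log (by positivity) h'
  rw [Real.log_mul (by positivity) h0.ne', Real.log_pow] at this
  push_cast at this
  exact this

end FilesBelow

/-- The number of pairs of binary words of total length at most `d`. -/
theorem card_le_of_length_add_length_le {d : ℕ} (s : Finset (List (ZMod 2) × List (ZMod 2)))
    (hs : ∀ a ∈ s, a.1.length + a.2.length ≤ d) : s.card ≤ (d + 1) ^ 2 * 2 ^ d := by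
  have hcard : (Finset.univ : Finset ((Fin (d + 1) × Fin (d + 1)) × (Fin d → ZMod 2))).card =
      (d + 1) ^ 2 * 2 ^ d := by
    simp [sq]
  rw [← hcard]
  -- A pair is recovered from its two lengths and its concatenation padded with zeros to `d` bits.
  refine Finset.card_le_card_of_injOn (fun a => ((Fin.ofNat (d + 1) a.1.length,
    Fin.ofNat (d + 1) a.2.length), fun i => (a.1 ++ a.2).getD i 0)) (by intro; simp) ?_
  rintro ⟨a, b⟩ hab ⟨a', b'⟩ hab' h
  have h1 := hs _ hab
  have h2 := hs _ hab'
  simp only [Prod.mk.injEq, Fin.ofNat, Fin.mk.injEq] at h h1 h2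
  obtain ⟨⟨ha, hb⟩, h⟩ := h
  rw [Nat.mod_eq_of_lt (by omega), Nat.mod_eq_of_lt (by omega)] at ha hb
  have happ : a ++ b = a' ++ b' := by
    refine List.ext_getElem (by simp [ha, hb]) fun i hi hi' => ?_
    have hid : i < d := by
      simp only [List.length_append] at hi
      omega
    have := congrFun h ⟨i, hid⟩
    simpa only [List.getD_eq_getElem _ _ hi, List.getD_eq_getElem _ _ hi'] using this
  obtain ⟨rfl, rfl⟩ := List.append_inj happ ha
  rfl

theorem databaseLaw_toOuterMeasure_coe {K F L : ℕ} (s : Finset (Database K F L)) :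
    (databaseLaw K F L).toOuterMeasure s = (s.card : ℝ≥0∞) / Fintype.card (Database K F L) := by
  classical
  rw [databaseLaw, PMF.toOuterMeasure_uniformOfFintype_apply]
  simp

theorem combination_single {K F L : ℕ} (j : Fin K) (w : Database K F L) :
    combination (Pi.single j 1) w = fun t => w t j := by
  funext t
  rw [combination, Finset.sum_eq_single j]
  · simp
  · intro k _ hk
    simp [hk]
  · simp

/-! ### The converse at fixed size -/

namespace Protocol

variable {K : ℕ} {𝒱 : Set (Fin K → ZMod 2)} {F L : ℕ}

/-- The pair of answers to a given pair of queries. -/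
def answers (P : Protocol 𝒱 2 F L) (q : (n : Fin 2) → P.Query n) (w : Database K F L) :
    List (ZMod 2) × List (ZMod 2) :=
  (P.answer 0 (q 0) w, P.answer 1 (q 1) w)

open Classical in
/-- The databases which are decoded incorrectly for given queries. -/
def badDatabases (P : Protocol 𝒱 2 F L) (v : 𝒱) (q : (n : Fin 2) → P.Query n) :
    Finset (Database K F L) :=
  Finset.univ.filter fun w =>
    P.decode v q (fun n => P.answer n (q n) w) ≠ combination (v : Fin K → ZMod 2) w

/-- Queries and database are independent, so given the queries the error probability is the
proportion of bad databases. -/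
theorem mean_badDatabases_le (P : Protocol 𝒱 2 F L) (v : 𝒱) :
    (mean (P.queryLaw v) fun q =>
      ((P.badDatabases v q).card : ℝ≥0∞) / Fintype.card (Database K F L)) ≤ P.errorProb := by
  have h : (mean (P.queryLaw v) fun q =>
      ((P.badDatabases v q).card : ℝ≥0∞) / Fintype.card (Database K F L)) =
      (P.jointLaw v).toOuterMeasure {x | P.decode v x.1 (fun n => P.answer n (x.1 n) x.2) ≠
        combination (v : Fin K → ZMod 2) x.2} := by
    rw [jointLaw, PMF.toOuterMeasure_bind_apply]
    refine tsum_congr fun q => ?_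
    dsimp only
    rw [PMF.toOuterMeasure_map_apply, ← databaseLaw_toOuterMeasure_coe]
    congr 2
    ext w
    simp [badDatabases]
  rw [h]
  exact le_iSup (fun v : 𝒱 => (P.jointLaw v).toOuterMeasure
    {x | P.decode v x.1 (fun n => P.answer n (x.1 n) x.2) ≠
      combination (v : Fin K → ZMod 2) x.2}) v

/-- The conditional entropy of the answers given the first `j` files decreases by the entropy of a
file, up to Fano's correction, when the next file is decoded and revealed. -/
theorem log_add_condEntropy_le (P : Protocol 𝒱 2 F L) (hF : 1 ≤ F) (j : Fin K)
    (hj : Pi.single j 1 ∈ 𝒱) (q : (n : Fin 2) → P.Query n) :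
    L * F * Real.log 2 + condEntropy (P.answers q) (filesBelow (j + 1)) ≤
      condEntropy (P.answers q) (filesBelow (j : ℕ)) + Real.log 2 +
        (P.badDatabases ⟨_, hj⟩ q).card / Fintype.card (Database K F L) *
          (L * F * Real.log 2) := by
  classical
  have hΩ : (0 : ℝ) < Fintype.card (Database K F L) := by exact_mod_cast Fintype.card_pos
  -- Fano's inequality for guessing file `j` from the answers and the earlier files.
  have h1 := fiberLog_sub_fiberLog_le_of_guess
    (fun w : Database K F L => (P.answers q w, filesBelow (j : ℕ) w))
    (fun (w : Database K F L) t => w t j)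
    (fun a => P.decode ⟨_, hj⟩ q (Fin.cons a.1.1 (Fin.cons a.1.2 finZeroElim)))
  have hbad : (Finset.univ.filter fun w : Database K F L =>
      P.decode ⟨_, hj⟩ q (Fin.cons (P.answers q w).1 (Fin.cons (P.answers q w).2 finZeroElim)) ≠
        fun t => w t j) = P.badDatabases ⟨_, hj⟩ q := by
    rw [badDatabases]
    refine Finset.filter_congr fun w _ => ?_
    rw [combination_single]
    have : (Fin.cons (P.answers q w).1 (Fin.cons (P.answers q w).2 finZeroElim) :
        Fin 2 → List (ZMod 2)) = fun n => P.answer n (q n) w := by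
      funext n
      fin_cases n <;> rfl
    rw [this]
  have h2 := fiberLog_filesBelow_succ_le (L := L) hF j
  have h3 : fiberLog (fun w : Database K F L =>
        ((P.answers q w, filesBelow (j : ℕ) w), fun t => w t j)) =
      fiberLog fun w : Database K F L => (P.answers q w, filesBelow (j + 1) w) := by
    refine fiberLog_congr fun w w' => ?_
    simp only [Prod.mk.injEq, filesBelow_succ_eq_iff, funext_iff (g := fun t => w' t j), and_assoc]
  simp only [card_layers hF, h3] at h1
  rw [hbad] at h1
  push_cast [Real.log_pow] at h1
  rw [condEntropy, condEntropy, div_mul_eq_mul_div, ← sub_nonneg]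
  have : 0 ≤ ((fiberLog (filesBelow (j : ℕ) : Database K F L → _) -
        fiberLog fun w : Database K F L => (P.answers q w, filesBelow (j : ℕ) w)) +
      Fintype.card (Database K F L) * Real.log 2 +
      (P.badDatabases ⟨_, hj⟩ q).card * (L * F * Real.log 2) -
      (Fintype.card (Database K F L) * (L * F * Real.log 2) +
      (fiberLog (filesBelow (j + 1) : Database K F L → _) -
        fiberLog fun w : Database K F L => (P.answers q w, filesBelow (j + 1) w)))) /
      Fintype.card (Database K F L) := div_nonneg (by linarith) hΩ.le
  refine this.trans_eq ?_
  field_simp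

/-- Answer lengths may depend on the files and carry information themselves; this costs the extra `2
* log (d + 1)`. -/
theorem condEntropy_answers_zero_le (P : Protocol 𝒱 2 F L) {d : ℕ}
    (q : (n : Fin 2) → P.Query n) (hq : ∀ w, ∑ n, (P.answer n (q n) w).length ≤ d) :
    condEntropy (P.answers q) (filesBelow 0) ≤ 2 * Real.log (d + 1) + d * Real.log 2 := by
  classical
  have h0 : (filesBelow 0 : Database K F L → _) = fun _ => 0 := by
    funext w t k
    simp [filesBelow]
  rw [h0]
  refine (condEntropy_const_le _ _ (card_le_of_length_add_length_le (d := d) _ ?_)).trans_eq ?_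
  · intro a ha
    obtain ⟨w, -, rfl⟩ := Finset.mem_image.1 ha
    simpa [Fin.sum_univ_two, answers] using hq w
  · push_cast
    rw [Real.log_mul (by positivity) (by positivity), Real.log_pow, Real.log_pow]
    push_cast
    rfl

/-- The conditional entropy of the answers given the queries and the first `j` files. -/
def answerEntropy (P : Protocol 𝒱 2 F L) (j : ℕ) (v : 𝒱) : ℝ≥0∞ :=
  mean (P.queryLaw v) fun q => ENNReal.ofReal (condEntropy (P.answers q) (filesBelow j))

theorem answerEntropy_ne_top (P : Protocol 𝒱 2 F L) (j : ℕ) (v : 𝒱) :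
    P.answerEntropy j v ≠ ⊤ := by
  have h : P.answerEntropy j v ≤
      ENNReal.ofReal (Real.log (Fintype.card (Database K F L))) := by
    rw [← mean_const (P.queryLaw v) (ENNReal.ofReal _)]
    exact mean_mono fun q _ => ENNReal.ofReal_le_ofReal (condEntropy_le_log_card _ _)
  exact (h.trans_lt ENNReal.ofReal_lt_top).ne

/-- By privacy, the entropy of a single answer does not depend on the vector, so that the entropies
of the pair of answers for two vectors differ at most by a factor two. -/
theorem answerEntropy_le_two_mul {P : Protocol 𝒱 2 F L} (hP : P.IsPrivate) (j : ℕ) (v v' : 𝒱) :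
    P.answerEntropy j v' ≤ 2 * P.answerEntropy j v := by
  let H : (n : Fin 2) → P.Query n → ℝ≥0∞ := fun n c =>
    ENNReal.ofReal (condEntropy (P.answer n c) (filesBelow j))
  have hind : ∀ n, (mean (P.queryLaw v') fun q => H n (q n)) =
      mean (P.queryLaw v) fun q => H n (q n) := fun n => by
    rw [← mean_map _ (fun q : (n : Fin 2) → P.Query n => q n) (H n),
      ← mean_map _ (fun q : (n : Fin 2) → P.Query n => q n) (H n), hP.map_queryLaw_eq n v v']
  have hle : ∀ n, (mean (P.queryLaw v) fun q => H n (q n)) ≤ P.answerEntropy j v := fun n =>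
    mean_mono fun q _ => ENNReal.ofReal_le_ofReal (condEntropy_le_of_factors _ fun w w' h => by
      rw [answers, answers, Prod.mk.injEq] at h
      fin_cases n
      exacts [h.1, h.2])
  calc P.answerEntropy j v'
      ≤ mean (P.queryLaw v') fun q => H 0 (q 0) + H 1 (q 1) := mean_mono fun q _ => by
        simp only [H]
        rw [← ENNReal.ofReal_add (condEntropy_nonneg _ _) (condEntropy_nonneg _ _)]
        exact ENNReal.ofReal_le_ofReal (condEntropy_prod_le _ _ _)
    _ ≤ 2 * P.answerEntropy j v := by
        rw [mean_add, hind, hind, two_mul]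
        exact add_le_add (hle 0) (hle 1)

theorem errorProb_ne_top (P : Protocol 𝒱 2 F L) : P.errorProb ≠ ⊤ := by
  have : P.errorProb ≤ 1 := iSup_le fun v => by
    rw [PMF.toOuterMeasure_apply, ← (P.jointLaw v).tsum_coe]
    exact ENNReal.tsum_le_tsum fun x => Set.indicator_le_self _ _ x
  exact (this.trans_lt ENNReal.one_lt_top).ne

/-- The inequality for fixed queries is averaged in `ℝ≥0∞`, hence kept free of subtraction; all
terms being finite, it then passes to `ℝ`. -/
theorem log_add_answerEntropy_le (P : Protocol 𝒱 2 F L) (hF : 1 ≤ F) (j : Fin K)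
    (hj : Pi.single j 1 ∈ 𝒱) :
    L * F * Real.log 2 + (P.answerEntropy (j + 1) ⟨_, hj⟩).toReal ≤
      (P.answerEntropy j ⟨_, hj⟩).toReal + Real.log 2 +
        P.errorProb.toReal * (L * F * Real.log 2) := by
  have hΩ : (0 : ℝ) < Fintype.card (Database K F L) := by exact_mod_cast Fintype.card_pos
  have hlog : (0 : ℝ) ≤ Real.log 2 := Real.log_nonneg one_le_two
  have h : ENNReal.ofReal (L * F * Real.log 2) + P.answerEntropy (j + 1) ⟨_, hj⟩ ≤
      P.answerEntropy j ⟨_, hj⟩ + ENNReal.ofReal (Real.log 2) +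
        P.errorProb * ENNReal.ofReal (L * F * Real.log 2) := by
    refine le_trans ?_ (add_le_add_right (mul_le_mul_left (P.mean_badDatabases_le ⟨_, hj⟩) _) _)
    rw [← mean_mul_const, ← mean_const (P.queryLaw ⟨_, hj⟩) (ENNReal.ofReal (Real.log 2)),
      answerEntropy, answerEntropy, ← mean_add, ← mean_add,
      ← mean_const (P.queryLaw ⟨_, hj⟩) (ENNReal.ofReal (L * F * Real.log 2)), ← mean_add]
    refine mean_mono fun q _ => ?_
    rw [mean_const]
    have e : ((P.badDatabases ⟨_, hj⟩ q).card : ℝ≥0∞) / Fintype.card (Database K F L) =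
        ENNReal.ofReal ((P.badDatabases ⟨_, hj⟩ q).card / Fintype.card (Database K F L)) := by
      rw [ENNReal.ofReal_div_of_pos hΩ, ENNReal.ofReal_natCast, ENNReal.ofReal_natCast]
    rw [e, ← ENNReal.ofReal_mul (by positivity),
      ← ENNReal.ofReal_add (by positivity) (condEntropy_nonneg _ _),
      ← ENNReal.ofReal_add (condEntropy_nonneg _ _) hlog,
      ← ENNReal.ofReal_add (add_nonneg (condEntropy_nonneg _ _) hlog) (by positivity)]
    exact ENNReal.ofReal_le_ofReal (P.log_add_condEntropy_le hF j hj q)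
  have h1 := P.answerEntropy_ne_top j ⟨_, hj⟩
  have h2 := P.answerEntropy_ne_top (j + 1) ⟨_, hj⟩
  have h3 := P.errorProb_ne_top
  have h4 : P.errorProb * ENNReal.ofReal (L * F * Real.log 2) ≠ ⊤ :=
    ENNReal.mul_ne_top h3 ENNReal.ofReal_ne_top
  have h5 : P.answerEntropy j ⟨_, hj⟩ + ENNReal.ofReal (Real.log 2) ≠ ⊤ :=
    ENNReal.add_ne_top.2 ⟨h1, ENNReal.ofReal_ne_top⟩
  have := ENNReal.toReal_mono (ENNReal.add_ne_top.2 ⟨h5, h4⟩) h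
  rw [ENNReal.toReal_add ENNReal.ofReal_ne_top h2, ENNReal.toReal_add h5 h4,
    ENNReal.toReal_add h1 ENNReal.ofReal_ne_top, ENNReal.toReal_mul,
    ENNReal.toReal_ofReal hlog, ENNReal.toReal_ofReal (by positivity)] at this
  exact this

/-- The non-asymptotic converse for two servers. -/
theorem log_two_mul_le_downloadCost {P : Protocol 𝒱 2 F L} (hP : P.IsPrivate) (hK : 1 ≤ K)
    (hF : 1 ≤ F) (h𝒱 : fileVectors K ⊆ 𝒱) {d : ℕ} (hd : P.HasDownloadCost d) :
    ((1 - P.errorProb.toReal) * (L * F * Real.log 2) - Real.log 2) *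
        (2 * (1 - 1 / (2 : ℝ) ^ K)) ≤
      2 * Real.log (d + 1) + d * Real.log 2 := by
  set a : ℝ := (1 - P.errorProb.toReal) * (L * F * Real.log 2) - Real.log 2 with ha
  have hmem : ∀ j : Fin K, Pi.single j 1 ∈ 𝒱 := fun j => h𝒱 ⟨j, rfl⟩
  have htwo : ∀ j v v', (P.answerEntropy j v').toReal ≤ 2 * (P.answerEntropy j v).toReal := by
    intro j v v'
    have := ENNReal.toReal_mono (ENNReal.mul_ne_top ENNReal.ofNat_ne_top
      (P.answerEntropy_ne_top j v)) (answerEntropy_le_two_mul hP j v v')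
    rwa [ENNReal.toReal_mul, ENNReal.toReal_ofNat] at this
  have hstep : ∀ j : Fin K, a + (P.answerEntropy (j + 1) ⟨_, hmem j⟩).toReal ≤
      (P.answerEntropy j ⟨_, hmem j⟩).toReal := fun j => by
    have := P.log_add_answerEntropy_le hF j (hmem j)
    rw [ha]
    linarith
  -- Here `i` counts the files not yet revealed. Privacy moves from `v` to the vector requesting
  -- file `j` at the price of a factor two, so each bound is half of `a` plus the next one.
  have hind : ∀ i j : ℕ, i + j = K → ∀ v,
      a * (1 - 1 / (2 : ℝ) ^ i) ≤ (P.answerEntropy j v).toReal := by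
    intro i
    induction i with
    | zero => intro j _ v; simp
    | succ i ih =>
      intro j hj v
      have h1 := htwo j v ⟨_, hmem ⟨j, by omega⟩⟩
      have h2 := hstep ⟨j, by omega⟩
      have h3 := ih (j + 1) (by omega) ⟨_, hmem ⟨j, by omega⟩⟩
      have e : a * (1 - 1 / (2 : ℝ) ^ (i + 1)) = (a + a * (1 - 1 / (2 : ℝ) ^ i)) / 2 := by
        rw [pow_succ]
        field_simp
        ring
      rw [e]
      dsimp only at h2
      linarith
  obtain ⟨i, rfl⟩ := Nat.exists_eq_add_of_le' hK
  -- At `j = 0` the cost bounds the answers for `e_0` directly, so no factor two is lost.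
  have h1 := hind i 1 (by omega) ⟨_, hmem 0⟩
  have h2 := hstep 0
  have h3 : (P.answerEntropy 0 ⟨_, hmem 0⟩).toReal ≤ 2 * Real.log (d + 1) + d * Real.log 2 := by
    have hn : 0 ≤ 2 * Real.log (d + 1) + d * Real.log 2 := by
      have : 0 ≤ Real.log (d + 1) := Real.log_nonneg (by linarith [(Nat.cast_nonneg d : (0 : ℝ) ≤ d)])
      positivity
    refine ENNReal.toReal_le_of_le_ofReal hn ?_
    rw [← mean_const (P.queryLaw ⟨_, hmem 0⟩) (ENNReal.ofReal _)]
    exact mean_mono fun q hq => ENNReal.ofReal_le_ofReal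
      (P.condEntropy_answers_zero_le q fun w => hd.2 ⟨_, q, w, hq, rfl⟩)
  have e : a * (2 * (1 - 1 / (2 : ℝ) ^ (i + 1))) = a + a * (1 - 1 / (2 : ℝ) ^ i) := by
    rw [pow_succ]
    field_simp
    ring
  rw [e]
  simp only [Fin.val_zero, zero_add] at h2
  linarith

end Protocol

/-! ### Passage to the limit and capacity -/

theorem IsAchievable.le_capacity {K F : ℕ} (hK : 1 ≤ K) (hF : 1 ≤ F)
    {𝒱 : Set (Fin K → ZMod 2)} (h𝒱 : fileVectors K ⊆ 𝒱) {R : ℝ} (hR : IsAchievable 𝒱 2 F R) :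
    R ≤ (1 / 2 : ℝ) * (1 - 1 / (2 : ℝ) ^ K)⁻¹ := by
  obtain ⟨L, Q, S, hL, hrate, herr⟩ := hR
  have hpow : 1 / (2 : ℝ) ^ K < 1 := by
    rw [div_lt_one (by positivity)]
    exact one_lt_pow₀ one_lt_two (by omega)
  have hc : (0 : ℝ) < 2 * (1 - 1 / (2 : ℝ) ^ K) := by linarith
  have hC : (1 / 2 : ℝ) * (1 - 1 / (2 : ℝ) ^ K)⁻¹ = 1 / (2 * (1 - 1 / (2 : ℝ) ^ K)) := by
    rw [one_div 2, ← mul_inv, one_div (2 * _)]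
  rw [hC]
  set c : ℝ := 2 * (1 - 1 / (2 : ℝ) ^ K)
  -- A scheme with `Q = 0` has rate `L / 0 = 0`; only a positive limit forces `Q > 0` eventually.
  rcases le_or_gt R 0 with hR0 | hR0
  · exact hR0.trans (by positivity)
  have hlog : (0 : ℝ) < Real.log 2 := Real.log_pos one_lt_two
  have hF' : (1 : ℝ) ≤ F := by exact_mod_cast hF
  have hpos : ∀ᶠ m in atTop, (0 : ℝ) < Q m := by
    filter_upwards [hrate.eventually_const_lt hR0] with m hm
    refine lt_of_le_of_ne (Nat.cast_nonneg _) fun h => ?_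
    rw [← h, div_zero] at hm
    exact lt_irrefl _ hm
  -- Eventually `L / Q < R + 1`, so `Q` grows with `L`.
  have hx : Tendsto (fun m => (Q m : ℝ) * F) atTop atTop := by
    refine tendsto_atTop_mono' _ ?_
      ((tendsto_natCast_atTop_atTop.comp hL).atTop_div_const (show (0 : ℝ) < R + 1 by linarith))
    filter_upwards [hpos, hrate.eventually_lt_const (lt_add_one R)] with m h0 h1
    rw [div_lt_iff₀ h0] at h1
    rw [Function.comp_apply, div_le_iff₀ (by linarith)]
    nlinarith [mul_nonneg h0.le (sub_nonneg.2 hF'), mul_pos h0 (show (0 : ℝ) < R + 1 by linarith)]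
  have hε : Tendsto (fun m => (S m).errorProb.toReal) atTop (𝓝 0) := by
    exact (ENNReal.tendsto_toReal ENNReal.zero_ne_top).comp herr
  have hlogdiv : Tendsto (fun m => Real.log ((Q m : ℝ) * F + 1) / ((Q m : ℝ) * F)) atTop (𝓝 0) := by
    refine ((Real.tendsto_pow_log_div_mul_add_atTop 1 (-1) 1 one_ne_zero).comp
      (tendsto_atTop_add_const_right _ 1 hx)).congr fun m => ?_
    simp
  have hleft : Tendsto (fun m => ((1 - (S m).errorProb.toReal) * ((L m : ℝ) / Q m) -
      ((Q m : ℝ) * F)⁻¹) * c) atTop (𝓝 (((1 - 0) * R - 0) * c)) :=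
    (((hε.const_sub 1).mul hrate).sub hx.inv_tendsto_atTop).mul_const c
  have hright : Tendsto (fun m => 2 / Real.log 2 *
      (Real.log ((Q m : ℝ) * F + 1) / ((Q m : ℝ) * F)) + 1) atTop
      (𝓝 (2 / Real.log 2 * 0 + 1)) := (hlogdiv.const_mul _).add_const 1
  have hle := le_of_tendsto_of_tendsto hleft hright (by
    filter_upwards [hpos] with m h0
    have h := Protocol.log_two_mul_le_downloadCost (S m).isPrivate hK hF h𝒱
      (S m).hasDownloadCost
    have hx0 : 0 < (Q m : ℝ) * F := by positivity
    push_cast at h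
    rw [← mul_le_mul_iff_left₀ (mul_pos hx0 hlog)]
    refine (le_of_eq ?_).trans (h.trans (le_of_eq ?_))
    · change _ = ((1 - (S m).errorProb.toReal) * _ - _) * c
      field_simp
    · field_simp)
  rw [le_div_iff₀ hc]
  linarith

theorem isAchievable_capacity {K F : ℕ} (hK : 1 ≤ K) (hF : 1 ≤ F)
    {𝒱 : Set (Fin K → ZMod 2)} (h𝒱 : 𝒱.Nonempty) :
    IsAchievable 𝒱 2 F ((1 / 2 : ℝ) * (1 - 1 / (2 : ℝ) ^ K)⁻¹) := by
  -- Taking `m + 1` copies keeps the rate from being `0 / 0` at `m = 0`.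
  choose S hS using fun m : ℕ => exists_scheme_errorProb_eq_zero (m := m + 1) h𝒱 hF rfl rfl
  refine ⟨_, _, S, ?_, ?_, ?_⟩
  · exact (tendsto_add_atTop_nat 1).atTop_mul_const' (by positivity)
  · have h1 : (1 : ℝ) < 2 ^ K := one_lt_pow₀ one_lt_two (by omega)
    refine tendsto_const_nhds.congr fun m => ?_
    have h2 : (2 : ℝ) ^ K - 1 ≠ 0 := by linarith
    have h3 : ((m : ℝ) + 1) ≠ 0 := by positivity
    push_cast [Nat.cast_sub (Nat.one_le_two_pow (n := K))]
    field_simp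
  · simp only [hS, tendsto_const_nhds]

/-- The converse uses only the unit vectors and the scheme serves any nonempty family, so function
and file retrieval share one capacity. -/
theorem isCapacity_of_fileVectors_subset {K F : ℕ} (hK : 1 ≤ K) (hF : 1 ≤ F)
    {𝒱 : Set (Fin K → ZMod 2)} (h𝒱 : fileVectors K ⊆ 𝒱) :
    IsCapacity 𝒱 2 F ((1 / 2 : ℝ) * (1 - 1 / (2 : ℝ) ^ K)⁻¹) :=
  ⟨fun _ hR => hR.le_capacity hK hF h𝒱, fun _ hB =>
    hB (isAchievable_capacity hK hF ⟨_, h𝒱 ⟨⟨0, hK⟩, rfl⟩⟩)⟩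

theorem fileVectors_subset_functionVectors (K : ℕ) : fileVectors K ⊆ functionVectors K := by
  rintro _ ⟨k, rfl⟩
  simp [functionVectors]

end PFR

end

theorem theorem1 (K F : ℕ) (hK : 1 ≤ K) (hF : 1 ≤ F) :
    PFR.IsCapacity (PFR.functionVectors K) 2 F ((1 / 2 : ℝ) * (1 - 1 / (2 : ℝ) ^ K)⁻¹) ∧
    PFR.IsCapacity (PFR.fileVectors K) 2 F ((1 / 2 : ℝ) * (1 - 1 / (2 : ℝ) ^ K)⁻¹) ∧
    ∃ S : PFR.Scheme (PFR.functionVectors K) 2 F (2 ^ (K + 1)) (4 * (2 ^ K - 1)),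
      S.errorProb = 0 := by
  have hsub := PFR.fileVectors_subset_functionVectors K
  exact ⟨PFR.isCapacity_of_fileVectors_subset hK hF hsub,
    PFR.isCapacity_of_fileVectors_subset hK hF subset_rfl,
    PFR.exists_scheme_errorProb_eq_zero (m := 2) ⟨_, hsub ⟨⟨0, hK⟩, rfl⟩⟩ hF (by ring)
      (mul_assoc 2 2 _)⟩
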